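/- **Setting.** Let $k$ be a commutative ring. Algebras are associative $k$-algebras, not necessarily unital, and $\otimes=\otimes_k$. An algebra $A$ is *non-degenerate* if, for each $a\in A$, one has $a=0$ as soon as $ab=0$ for all $b\in A$, or $ba=0$ for all $b\in A$. Its *multiplier algebra* $\mathbb M(A)$ is the unital algebra of pairs $x=(\lambda,\rho)$ of $k$-linear maps $A\to A$ with $\lambda(ab)=\lambda(a)b$, $\rho(ab)=a\rho(b)$ and $a\lambda(b)=\rho(a)b$ for all $a,b\in A$, with product $(\lambda,\rho)(\lambda',\rho')=(\lambda\circ\lambda',\rho'\circ\rho)$; write $x\rhd a=\lambda(a)$, $a\lhd x=\rho(a)$. The algebra map $\iota_A:A\to\mathbb M(A)$ sends $a$ to (left multiplication by $a$, right multiplication by $a$). For $a\in A$, $a\otimes 1$ and $1\otimes a$ denote the obvious multipliers of $A\otimes A$. A *multiplier Hopf algebra* is a non-degenerate algebra $A$, projective as a $k$-module, with an algebra map $\Delta:A\to\mathbb M(A\otimes A)$ such that: - for all $a,b\in A$, $\Delta(a)(1\otimes b)$ and $(a\otimes 1)\Delta(b)$ lie in $\iota_{A\otimes A}(A\otimes A)$;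 write $\Delta(a)(1\otimes b)=\iota_{A\otimes A}(a_{(1,b)}\otimes a_{(2,b)})$ and $(b\otimes 1)\Delta(a)=\iota_{A\otimes A}(a_{(b,1)}\otimes a_{(b,2)})$ (summation understood); - $\Delta$ is coassociative: $b_{(1,c)(a,1)}\otimes b_{(1,c)(a,2)}\otimes b_{(2,c)}=b_{(a,1)}\otimes b_{(a,2)(1,c)}\otimes b_{(a,2)(2,c)}$ for all $a,b,c\in A$; - the maps $T_1,T_2:A\otimes A\to A\otimes A$, $T_1(a\otimes b)=a_{(1,b)}\otimes a_{(2,b)}$ and $T_2(a\otimes b)=b_{(a,1)}\otimes b_{(a,2)}$, are bijective. Such an $A$ has a unique *counit*, i.e. an algebra map $\varepsilon:A\to k$ with $b_{(a,1)}\varepsilon(b_{(a,2)})=ab$ and $\varepsilon(a_{(1,b)})a_{(2,b)}=ab$ for all $a,b\in A$. The *antipode* of $A$ is the unique linear map $S:A\to\mathbb M(A)$ such that, for all $a,b\in A$, $$S(a_{(1,b)})\rhd a_{(2,b)}=\varepsilon(a)b,\qquad b_{(a,1)}\lhd S(b_{(a,2)})=a\,\varepsilon(b).$$ For linear maps $f,g:A\to\mathbb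 M(A)$ and $b\in A$, define linear maps $f\ast^b g,\ f\ast_b g,\ \alpha_b:A\to\mathbb M(A)$ by $$(f\ast^b g)(a)=f(a_{(1,b)})\,g(a_{(2,b)}),\qquad (f\ast_b g)(a)=f(a_{(b,1)})\,g(a_{(b,2)}),\qquad \alpha_b(a)=\varepsilon(a)\,\iota_A(b).$$ A linear map $\bar f:A\to\mathbb M(A)$ is a *(left-right) convolution inverse* of $f$ if $\bar f\ast^b f=\alpha_b=f\ast_b\bar f$ for all $b\in A$. **Proposition.** Let $A$ be a multiplier Hopf algebra. A linear map $S:A\to\mathbb M(A)$ is the antipode of $A$ if and only if $S$ is a (left-right) convolution inverse of $\iota_A$ in $\mathrm{Hom}(A,\mathbb M(A))$. -/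

import Mathlib

open scoped TensorProduct

noncomputable section

namespace MultiplierHopf

/-! ### Non-degenerate algebras and their multipliers -/

section Multipliers

/-- An algebra is non-degenerate if `a = 0` as soon as `a b = 0` for all `b`, or `b a = 0` for
all `b`. -/
def Nondegenerate (A : Type*) [NonUnitalRing A] : Prop :=
  (∀ a : A, (∀ b : A, a * b = 0) → a = 0) ∧ (∀ a : A, (∀ b : A, b * a = 0) → a = 0)

variable (k A : Type*) [CommRing k] [NonUnitalRing A] [Module k A]
  [IsScalarTower k A A] [SMulCommClass k A A]

/-- The pairs `(l, r)` of a right `A`-linear map `l` and a left `A`-linear map `r` with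
`a * l b = r a * b`, as a subalgebra of `End(A) × End(A)ᵒᵖ`. -/
def multiplierSubalgebra : Subalgebra k (Module.End k A × (Module.End k A)ᵐᵒᵖ) where
  carrier := {x | (∀ a b, x.1 (a * b) = x.1 a * b) ∧
    (∀ a b, x.2.unop (a * b) = a * x.2.unop b) ∧ ∀ a b, a * x.1 b = x.2.unop a * b}
  mul_mem' := by
    rintro x y ⟨hx1, hx2, hx3⟩ ⟨hy1, hy2, hy3⟩
    refine ⟨fun a b => ?_, fun a b => ?_, fun a b => ?_⟩
    · simp [hx1, hy1]
    · simp [hx2, hy2]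
    · simp [hx3, hy3]
  add_mem' := by
    rintro x y ⟨hx1, hx2, hx3⟩ ⟨hy1, hy2, hy3⟩
    refine ⟨fun a b => ?_, fun a b => ?_, fun a b => ?_⟩
    · simp [hx1, hy1, add_mul]
    · simp [hx2, hy2, mul_add]
    · simp [hx3, hy3, mul_add, add_mul]
  algebraMap_mem' := by
    intro c
    refine ⟨fun a b => ?_, fun a b => ?_, fun a b => ?_⟩
    · simp [smul_mul_assoc]
    · simp [mul_smul_comm]
    · simp [smul_mul_assoc, mul_smul_comm]

/-- The multiplier algebra `𝕄(A)`: pairs `(l, r)` of a right `A`-linear map `l` and a left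
`A`-linear map `r` with `a * l b = r a * b`, and with product `(l ∘ l', r' ∘ r)`. -/
def Multiplier : Type _ := multiplierSubalgebra k A

instance : Ring (Multiplier k A) := inferInstanceAs (Ring (multiplierSubalgebra k A))

instance : Algebra k (Multiplier k A) := inferInstanceAs (Algebra k (multiplierSubalgebra k A))

variable {k A}

namespace Multiplier

/-- The left action `x ▷ a = l a` of a multiplier `x = (l, r)` on `A`. -/
def leftAct : Multiplier k A →ₗ[k] A →ₗ[k] A :=
  LinearMap.fst k _ _ ∘ₗ (multiplierSubalgebra k A).val.toLinearMap

/-- The right action `a ◁ x = r a` of a multiplier `x = (l, r)` on `A`. -/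
def rightAct : Multiplier k A →ₗ[k] A →ₗ[k] A :=
  (MulOpposite.opLinearEquiv k).symm.toLinearMap ∘ₗ
    LinearMap.snd k _ _ ∘ₗ (multiplierSubalgebra k A).val.toLinearMap

theorem ext_act {x y : Multiplier k A} (h1 : leftAct x = leftAct y)
    (h2 : rightAct x = rightAct y) : x = y :=
  Subtype.ext (Prod.ext h1 (MulOpposite.unop_injective h2))

/-- The multiplier given by a compatible pair of a left and a right multiplier. -/
def mk (l r : A →ₗ[k] A) (hl : ∀ a b, l (a * b) = l a * b) (hr : ∀ a b, r (a * b) = a * r b)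
    (h : ∀ a b, a * l b = r a * b) : Multiplier k A :=
  ⟨(l, MulOpposite.op r), hl, hr, h⟩

theorem leftAct_mk (l r : A →ₗ[k] A) (hl hr h) : leftAct (mk l r hl hr h) = l := rfl

theorem rightAct_mk (l r : A →ₗ[k] A) (hl hr h) : rightAct (mk l r hl hr h) = r := rfl

theorem mul_leftAct (x y : Multiplier k A) (a : A) :
    leftAct (x * y) a = leftAct x (leftAct y a) := rfl

theorem mul_rightAct (x y : Multiplier k A) (a : A) :
    rightAct (x * y) a = rightAct y (rightAct x a) := rfl

theorem leftAct_mul (x : Multiplier k A) (a b : A) :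
    leftAct x (a * b) = leftAct x a * b := x.2.1 a b

theorem rightAct_mul (x : Multiplier k A) (a b : A) :
    rightAct x (a * b) = a * rightAct x b := x.2.2.1 a b

theorem act_compat (x : Multiplier k A) (a b : A) :
    a * leftAct x b = rightAct x a * b := x.2.2.2 a b

variable (k A) in
/-- The canonical algebra map `ι_A : A → 𝕄(A)`, sending `a` to left and right multiplication
by `a`. -/
def incl : A →ₙₐ[k] Multiplier k A where
  toFun a := mk (LinearMap.mulLeft k a) (LinearMap.mulRight k a)
    (fun b c => by simp [mul_assoc]) (fun b c => by simp [mul_assoc])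
    (fun b c => by simp [mul_assoc])
  map_smul' c a := ext_act (LinearMap.ext fun b => smul_mul_assoc c a b)
    (LinearMap.ext fun b => mul_smul_comm c b a)
  map_zero' := ext_act (LinearMap.ext fun b => zero_mul b) (LinearMap.ext fun b => mul_zero b)
  map_add' a b := ext_act (LinearMap.ext fun c => add_mul a b c)
    (LinearMap.ext fun c => mul_add c a b)
  map_mul' a b := ext_act (LinearMap.ext fun c => mul_assoc a b c)
    (LinearMap.ext fun c => (mul_assoc c a b).symm)

@[simp] theorem leftAct_incl (a b : A) : leftAct (incl k A a) b = a * b := rfl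

@[simp] theorem rightAct_incl (a b : A) : rightAct (incl k A a) b = b * a := rfl

theorem mul_incl (x : Multiplier k A) (a : A) : x * incl k A a = incl k A (leftAct x a) :=
  ext_act (by ext b; simp only [mul_leftAct, leftAct_incl, leftAct_mul])
    (by ext b; simp only [mul_rightAct, rightAct_incl, act_compat])

theorem incl_mul (x : Multiplier k A) (a : A) : incl k A a * x = incl k A (rightAct x a) :=
  ext_act (by ext b; simp only [mul_leftAct, leftAct_incl, act_compat])
    (by ext b; simp only [mul_rightAct, rightAct_incl, rightAct_mul])

theorem incl_injective (hA : Nondegenerate A) :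
    Function.Injective (incl k A) := by
  intro a b hab
  rw [← sub_eq_zero]
  refine hA.1 _ fun c => ?_
  have := congrArg (fun x => leftAct x c) hab
  simpa [sub_mul, sub_eq_zero] using this

variable {B : Type*} [NonUnitalRing B] [Module k B] [IsScalarTower k B B] [SMulCommClass k B B]

/-- The multiplier `x ⊗ y` of `A ⊗ B` acting as `x` on the first and as `y` on the second
factor. -/
def tensor (x : Multiplier k A) (y : Multiplier k B) : Multiplier k (A ⊗[k] B) :=
  mk (TensorProduct.map (leftAct x) (leftAct y)) (TensorProduct.map (rightAct x) (rightAct y))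
    (fun s t => by
      induction s with
      | zero => simp
      | add s s' hs hs' => rw [add_mul, map_add, hs, hs', map_add, add_mul]
      | tmul a b =>
        induction t with
        | zero => simp
        | add t t' ht ht' => rw [mul_add, map_add, ht, ht', mul_add]
        | tmul c d =>
          simp only [Algebra.TensorProduct.tmul_mul_tmul, TensorProduct.map_tmul, leftAct_mul])
    (fun s t => by
      induction s with
      | zero => simp
      | add s s' hs hs' => rw [add_mul, map_add, hs, hs', add_mul]
      | tmul a b =>
        induction t with
        | zero => simp
        | add t t' ht ht' => rw [mul_add, map_add, ht, ht', map_add, mul_add]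
        | tmul c d =>
          simp only [Algebra.TensorProduct.tmul_mul_tmul, TensorProduct.map_tmul, rightAct_mul])
    (fun s t => by
      induction s with
      | zero => simp
      | add s s' hs hs' => rw [add_mul, hs, hs', map_add, add_mul]
      | tmul a b =>
        induction t with
        | zero => simp
        | add t t' ht ht' => rw [map_add, mul_add, ht, ht', mul_add]
        | tmul c d =>
          simp only [Algebra.TensorProduct.tmul_mul_tmul, TensorProduct.map_tmul, act_compat])

theorem leftAct_tensor (x : Multiplier k A) (y : Multiplier k B) :
    leftAct (tensor x y) = TensorProduct.map (leftAct x) (leftAct y) := rfl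

theorem rightAct_tensor (x : Multiplier k A) (y : Multiplier k B) :
    rightAct (tensor x y) = TensorProduct.map (rightAct x) (rightAct y) := rfl

/-- The multiplier `1 ⊗ b`, linearly in `b`. -/
def oneTensor : B →ₗ[k] Multiplier k (A ⊗[k] B) where
  toFun b := tensor 1 (incl k B b)
  map_add' b c := ext_act
    (by simp only [map_add, leftAct_tensor, TensorProduct.map_add_right])
    (by simp only [map_add, rightAct_tensor, TensorProduct.map_add_right])
  map_smul' c b := ext_act
    (by simp only [map_smul, leftAct_tensor, TensorProduct.map_smul_right, RingHom.id_apply])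
    (by simp only [map_smul, rightAct_tensor, TensorProduct.map_smul_right, RingHom.id_apply])

/-- The multiplier `a ⊗ 1`, linearly in `a`. -/
def tensorOne : A →ₗ[k] Multiplier k (A ⊗[k] B) where
  toFun a := tensor (incl k A a) 1
  map_add' b c := ext_act
    (by simp only [map_add, leftAct_tensor, TensorProduct.map_add_left])
    (by simp only [map_add, rightAct_tensor, TensorProduct.map_add_left])
  map_smul' c b := ext_act
    (by simp only [map_smul, leftAct_tensor, TensorProduct.map_smul_left, RingHom.id_apply])
    (by simp only [map_smul, rightAct_tensor, TensorProduct.map_smul_left, RingHom.id_apply])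

end Multiplier

end Multipliers

/-! ### Tensor products of non-degenerate projective algebras -/

section TensorNondegenerate

variable {k A B : Type*} [CommRing k] [NonUnitalRing A] [Module k A]
  [IsScalarTower k A A] [SMulCommClass k A A]
  [NonUnitalRing B] [Module k B] [IsScalarTower k B B] [SMulCommClass k B B]

/-- Functionals on a projective factor separate the elements of a tensor product. -/
theorem eq_zero_of_forall_dual {k M N : Type*} [CommRing k] [AddCommGroup M] [Module k M]
    [AddCommGroup N] [Module k N] [Module.Projective k N] (t : M ⊗[k] N)
    (h : ∀ φ : Module.Dual k N, TensorProduct.rid k M (LinearMap.lTensor M φ t) = 0) :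
    t = 0 := by
  classical
  obtain ⟨s, hs⟩ := (Module.projective_def' (R := k) (P := N)).1 inferInstance
  have hinj : LinearMap.lTensor M s t = 0 := by
    apply (TensorProduct.finsuppScalarRight k k M N).injective
    ext i
    rw [map_zero, Finsupp.zero_apply, ← h (Finsupp.lapply i ∘ₗ s), LinearMap.lTensor_comp_apply]
    generalize LinearMap.lTensor M s t = u
    induction u with
    | zero => simp
    | add u v hu hv => simp [hu, hv]
    | tmul m f => simp
  rw [← LinearMap.id_apply (R := k) t, ← LinearMap.lTensor_id, ← hs, LinearMap.lTensor_comp_apply,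
    hinj, map_zero]

theorem functional_eq_zero {k M : Type*} [CommRing k] [AddCommGroup M] [Module k M]
    [Module.Projective k M] {d : M →ₗ[k] k}
    (h : ∀ a b : M, d a • b = 0) : d = 0 := by
  obtain ⟨s, hs⟩ := (Module.projective_def (R := k) (P := M)).1 inferInstance
  ext a
  have h1 : d a = (s a).sum fun x r => r * d x := by
    conv_lhs => rw [← hs a]
    simp [Finsupp.linearCombination_apply, map_finsuppSum]
  rw [h1]
  refine Finset.sum_eq_zero fun x _ => ?_
  have h2 := congrArg (fun y => s y x) (h x a)
  simpa [mul_comm] using h2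

theorem eq_zero_of_tmul_eq_zero {k M : Type*} [CommRing k] [AddCommGroup M] [Module k M]
    [Module.Projective k M] {y : M}
    (h : ∀ c : M, y ⊗ₜ[k] c = 0) : y = 0 := by
  obtain ⟨s, hs⟩ := (Module.projective_def (R := k) (P := M)).1 inferInstance
  have h0 : ∀ (φ : M →ₗ[k] k) (c : M), φ c • y = 0 := by
    intro φ c
    have := congrArg (fun t => TensorProduct.rid k M (LinearMap.lTensor M φ t)) (h c)
    simpa using this
  rw [← Module.forall_dual_apply_eq_zero_iff k]
  intro φ
  have h1 : φ y = (s y).sum fun x r => r * φ x := by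
    conv_lhs => rw [← hs y]
    simp [Finsupp.linearCombination_apply, map_finsuppSum]
  rw [h1]
  refine Finset.sum_eq_zero fun x _ => ?_
  have h2 := congrArg (fun y => s y x) (h0 φ x)
  simpa [mul_comm] using h2

theorem exists_functional {k A : Type*} [CommRing k] [AddCommGroup A] [Module k A]
    [Module.Projective k A] (e₁ e₂ : A ⊗[k] A →ₗ[k] A)
    (h : ∀ a b c : A, a ⊗ₜ[k] e₁ (b ⊗ₜ c) = e₂ (a ⊗ₜ b) ⊗ₜ[k] c) :
    ∃ ε : A →ₗ[k] k, (∀ b c, e₁ (b ⊗ₜ c) = ε b • c) ∧ ∀ a b, e₂ (a ⊗ₜ b) = ε b • a := by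
  obtain ⟨s, hs⟩ := (Module.projective_def (R := k) (P := A)).1 inferInstance
  have h0 : ∀ (φ : A →ₗ[k] k) (a b c : A), φ a • e₁ (b ⊗ₜ c) = φ (e₂ (a ⊗ₜ b)) • c := by
    intro φ a b c
    have := congrArg (fun t => TensorProduct.lid k A (LinearMap.rTensor A φ t)) (h a b c)
    simpa using this
  have hsum : ∀ b : A, b = (s b).sum fun x r => r • x := fun b => by
    conv_lhs => rw [← hs b]
    simp [Finsupp.linearCombination_apply]
  have h1 : ∀ b : A, ∃ r : k, ∀ c : A, e₁ (b ⊗ₜ c) = r • c := by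
    intro b
    refine ⟨(s b).sum fun x _ => s (e₂ (b ⊗ₜ x)) x, fun c => ?_⟩
    conv_lhs => rw [hsum b]
    rw [Finsupp.sum, TensorProduct.sum_tmul, map_sum, Finsupp.sum, Finset.sum_smul]
    refine Finset.sum_congr rfl fun x _ => ?_
    rw [← TensorProduct.smul_tmul', map_smul]
    exact h0 (Finsupp.lapply x ∘ₗ s) b x c
  choose η hη using h1
  have hε : ∀ b c : A, e₁ (b ⊗ₜ c) = (Finsupp.linearCombination k η ∘ₗ s) b • c := by
    intro b c
    conv_lhs => rw [hsum b]
    rw [Finsupp.sum, TensorProduct.sum_tmul, map_sum, LinearMap.comp_apply,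
      Finsupp.linearCombination_apply, Finsupp.sum, Finset.sum_smul]
    refine Finset.sum_congr rfl fun x _ => ?_
    rw [← TensorProduct.smul_tmul', map_smul, hη, smul_assoc]
  refine ⟨_, hε, fun a b => ?_⟩
  rw [← sub_eq_zero]
  refine eq_zero_of_tmul_eq_zero (k := k) fun c => ?_
  rw [TensorProduct.sub_tmul, ← h, hε, TensorProduct.tmul_smul, TensorProduct.smul_tmul', sub_self]

theorem lid_lTensor_rTensor_comm {k M N : Type*} [CommRing k] [AddCommGroup M] [Module k M]
    [AddCommGroup N] [Module k N] (φ : Module.Dual k M) (ψ : Module.Dual k N) (t : M ⊗[k] N) :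
    φ (TensorProduct.rid k M (LinearMap.lTensor M ψ t)) =
      ψ (TensorProduct.lid k N (LinearMap.rTensor N φ t)) := by
  induction t with
  | zero => simp
  | add u v hu hv => simp [hu, hv]
  | tmul m n => simp [mul_comm]

theorem Nondegenerate.tensor [Module.Projective k A] [Module.Projective k B]
    (hA : Nondegenerate A) (hB : Nondegenerate B) : Nondegenerate (A ⊗[k] B) := by
  constructor
  · intro t ht
    refine eq_zero_of_forall_dual t fun ψ => hA.1 _ fun a => ?_
    rw [← Module.forall_dual_apply_eq_zero_iff k]
    intro φ
    change (φ ∘ₗ LinearMap.mulRight k a) _ = 0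
    rw [lid_lTensor_rTensor_comm]
    convert map_zero ψ
    refine hB.1 _ fun b => ?_
    have key : ∀ u : A ⊗[k] B,
        TensorProduct.lid k B (LinearMap.rTensor B (φ ∘ₗ LinearMap.mulRight k a) u) * b =
        TensorProduct.lid k B (LinearMap.rTensor B φ (u * (a ⊗ₜ b))) := by
      intro u
      induction u with
      | zero => simp
      | add u v hu hv => simp only [map_add, add_mul, hu, hv]
      | tmul x y => simp [smul_mul_assoc]
    rw [key, ht, map_zero, map_zero]
  · intro t ht
    refine eq_zero_of_forall_dual t fun ψ => hA.2 _ fun a => ?_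
    rw [← Module.forall_dual_apply_eq_zero_iff k]
    intro φ
    change (φ ∘ₗ LinearMap.mulLeft k a) _ = 0
    rw [lid_lTensor_rTensor_comm]
    convert map_zero ψ
    refine hB.2 _ fun b => ?_
    have key : ∀ u : A ⊗[k] B,
        b * TensorProduct.lid k B (LinearMap.rTensor B (φ ∘ₗ LinearMap.mulLeft k a) u) =
        TensorProduct.lid k B (LinearMap.rTensor B φ ((a ⊗ₜ b) * u)) := by
      intro u
      induction u with
      | zero => simp
      | add u v hu hv => simp only [map_add, mul_add, hu, hv]
      | tmul x y => simp [mul_smul_comm]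
    rw [key, ht, map_zero, map_zero]

end TensorNondegenerate

/-! ### Multiplier Hopf algebras -/

section Hopf

open Multiplier

variable {k A : Type*} [CommRing k] [NonUnitalRing A] [Module k A]
  [IsScalarTower k A A] [SMulCommClass k A A]

/-- The linear map `A ⊗ A → 𝕄(A ⊗ A)`, `a ⊗ b ↦ Δ(a)(1 ⊗ b)`. -/
def comulMul (Δ : A →ₙₐ[k] Multiplier k (A ⊗[k] A)) :
    A ⊗[k] A →ₗ[k] Multiplier k (A ⊗[k] A) :=
  LinearMap.mul' k _ ∘ₗ TensorProduct.map (Δ : A →ₗ[k] Multiplier k (A ⊗[k] A)) oneTensor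

/-- The linear map `A ⊗ A → 𝕄(A ⊗ A)`, `a ⊗ b ↦ (a ⊗ 1)Δ(b)`. -/
def mulComul (Δ : A →ₙₐ[k] Multiplier k (A ⊗[k] A)) :
    A ⊗[k] A →ₗ[k] Multiplier k (A ⊗[k] A) :=
  LinearMap.mul' k _ ∘ₗ TensorProduct.map tensorOne (Δ : A →ₗ[k] Multiplier k (A ⊗[k] A))

theorem comulMul_tmul (Δ : A →ₙₐ[k] Multiplier k (A ⊗[k] A)) (a b : A) :
    comulMul Δ (a ⊗ₜ b) = Δ a * oneTensor b := rfl

theorem mulComul_tmul (Δ : A →ₙₐ[k] Multiplier k (A ⊗[k] A)) (a b : A) :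
    mulComul Δ (a ⊗ₜ b) = tensorOne a * Δ b := rfl

/-- The canonical map `ι_{A ⊗ A} : A ⊗ A → 𝕄(A ⊗ A)` as a linear map. -/
def incl₂ : A ⊗[k] A →ₗ[k] Multiplier k (A ⊗[k] A) :=
  (incl k (A ⊗[k] A) : A ⊗[k] A →ₗ[k] Multiplier k (A ⊗[k] A))

theorem incl₂_injective [Module.Projective k A] (hA : Nondegenerate A) :
    Function.Injective (incl₂ : A ⊗[k] A →ₗ[k] Multiplier k (A ⊗[k] A)) :=
  incl_injective (hA.tensor hA)

theorem mem_range_of_tmul (F : A ⊗[k] A →ₗ[k] Multiplier k (A ⊗[k] A))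
    (h : ∀ a b : A, F (a ⊗ₜ b) ∈ LinearMap.range (incl₂ (k := k) (A := A))) (t : A ⊗[k] A) :
    F t ∈ LinearMap.range (incl₂ (k := k) (A := A)) := by
  induction t with
  | zero => rw [map_zero]; exact zero_mem _
  | add s t hs ht => rw [map_add]; exact add_mem hs ht
  | tmul a b => exact h a b

/-- A linear map into `𝕄(A ⊗ A)` with values in `ι_{A ⊗ A}(A ⊗ A)`, as a map into `A ⊗ A`. -/
def lift₂ [Module.Projective k A] (hA : Nondegenerate A)
    (F : A ⊗[k] A →ₗ[k] Multiplier k (A ⊗[k] A))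
    (h : ∀ a b : A, F (a ⊗ₜ b) ∈ LinearMap.range (incl₂ (k := k) (A := A))) :
    A ⊗[k] A →ₗ[k] A ⊗[k] A :=
  (LinearEquiv.ofInjective incl₂ (incl₂_injective hA)).symm.toLinearMap ∘ₗ
    F.codRestrict (LinearMap.range incl₂) (mem_range_of_tmul F h)

theorem incl₂_lift₂ [Module.Projective k A] (hA : Nondegenerate A)
    (F : A ⊗[k] A →ₗ[k] Multiplier k (A ⊗[k] A))
    (h : ∀ a b : A, F (a ⊗ₜ b) ∈ LinearMap.range (incl₂ (k := k) (A := A))) (t : A ⊗[k] A) :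
    incl k (A ⊗[k] A) (lift₂ hA F h t) = F t := by
  have := LinearEquiv.apply_symm_apply (LinearEquiv.ofInjective incl₂ (incl₂_injective hA))
    (F.codRestrict (LinearMap.range incl₂) (mem_range_of_tmul F h) t)
  exact congrArg Subtype.val this

variable (k A) in
/-- A multiplier Hopf algebra structure on a `k`-projective algebra `A`. -/
structure MultiplierHopfAlgebra [Module.Projective k A] where
  nondegenerate : Nondegenerate A
  /-- The comultiplication, an algebra map `A → 𝕄(A ⊗ A)`. -/
  comul : A →ₙₐ[k] Multiplier k (A ⊗[k] A)
  comul_mul_mem : ∀ a b : A,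
    comulMul comul (a ⊗ₜ b) ∈ LinearMap.range (incl₂ (k := k) (A := A))
  mul_comul_mem : ∀ a b : A,
    mulComul comul (a ⊗ₜ b) ∈ LinearMap.range (incl₂ (k := k) (A := A))
  /-- Coassociativity: `(a ⊗ 1 ⊗ 1)(Δ ⊗ A)(Δ(b)(1 ⊗ c)) = (A ⊗ Δ)((a ⊗ 1)Δ(b))(1 ⊗ 1 ⊗ c)`,
  as an identity in `A ⊗ A ⊗ A`. Here `x ⊗ y ↦ (a ⊗ 1)Δ(x) ⊗ y` is applied to `Δ(b)(1 ⊗ c)` and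
  `x ⊗ y ↦ x ⊗ Δ(y)(1 ⊗ c)` is applied to `(a ⊗ 1)Δ(b)`. -/
  coassoc : ∀ a b c : A,
    TensorProduct.assoc k A A A
      (LinearMap.rTensor A
        (lift₂ nondegenerate (mulComul comul) mul_comul_mem ∘ₗ TensorProduct.mk k A A a)
        (lift₂ nondegenerate (comulMul comul) comul_mul_mem (b ⊗ₜ c))) =
      LinearMap.lTensor A
        (lift₂ nondegenerate (comulMul comul) comul_mul_mem ∘ₗ (TensorProduct.mk k A A).flip c)
        (lift₂ nondegenerate (mulComul comul) mul_comul_mem (a ⊗ₜ b))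
  bijective_T₁ : Function.Bijective
    (lift₂ nondegenerate (comulMul comul) comul_mul_mem)
  bijective_T₂ : Function.Bijective
    (lift₂ nondegenerate (mulComul comul) mul_comul_mem)

namespace MultiplierHopfAlgebra

variable [Module.Projective k A] (H : MultiplierHopfAlgebra k A)

/-- `T₁ (a ⊗ b) = a_(1,b) ⊗ a_(2,b)`, the element of `A ⊗ A` with image `Δ(a)(1 ⊗ b)`. -/
def T₁ : A ⊗[k] A →ₗ[k] A ⊗[k] A :=
  lift₂ H.nondegenerate (comulMul H.comul) H.comul_mul_mem

/-- `T₂ (a ⊗ b) = b_(a,1) ⊗ b_(a,2)`, the element of `A ⊗ A` with image `(a ⊗ 1)Δ(b)`. -/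
def T₂ : A ⊗[k] A →ₗ[k] A ⊗[k] A :=
  lift₂ H.nondegenerate (mulComul H.comul) H.mul_comul_mem

theorem incl_T₁ (a b : A) : incl k (A ⊗[k] A) (H.T₁ (a ⊗ₜ b)) = H.comul a * oneTensor b :=
  incl₂_lift₂ _ _ _ _

theorem incl_T₂ (a b : A) : incl k (A ⊗[k] A) (H.T₂ (a ⊗ₜ b)) = tensorOne a * H.comul b :=
  incl₂_lift₂ _ _ _ _

/-- `ε : A → k` is a counit: an algebra map with `(A ⊗ ε)((a ⊗ 1)Δ(b)) = ab` and
`(ε ⊗ A)(Δ(a)(1 ⊗ b)) = ab`. -/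
def IsCounit (ε : A →ₙₐ[k] k) : Prop :=
  (∀ a b : A, TensorProduct.rid k A
    (LinearMap.lTensor A (ε : A →ₗ[k] k) (H.T₂ (a ⊗ₜ b))) = a * b) ∧
  (∀ a b : A, TensorProduct.lid k A
    (LinearMap.rTensor A (ε : A →ₗ[k] k) (H.T₁ (a ⊗ₜ b))) = a * b)

/-! #### Existence of the counit -/

theorem coassoc_apply (w : A ⊗[k] (A ⊗[k] A)) :
    TensorProduct.assoc k A A A (LinearMap.rTensor A H.T₂
      ((TensorProduct.assoc k A A A).symm (LinearMap.lTensor A H.T₁ w))) =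
    LinearMap.lTensor A H.T₁ (TensorProduct.assoc k A A A (LinearMap.rTensor A H.T₂
      ((TensorProduct.assoc k A A A).symm w))) := by
  have h1 : ∀ (a : A) (t : A ⊗[k] A),
      LinearMap.rTensor A H.T₂ ((TensorProduct.assoc k A A A).symm (a ⊗ₜ t)) =
        LinearMap.rTensor A (H.T₂ ∘ₗ TensorProduct.mk k A A a) t := by
    intro a t
    induction t with
    | zero => simp
    | add u v hu hv => simp only [TensorProduct.tmul_add, map_add, hu, hv]
    | tmul x y => simp
  have h2 : ∀ (c : A) (t : A ⊗[k] A),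
      LinearMap.lTensor A H.T₁ (TensorProduct.assoc k A A A (t ⊗ₜ c)) =
        LinearMap.lTensor A (H.T₁ ∘ₗ (TensorProduct.mk k A A).flip c) t := by
    intro c t
    induction t with
    | zero => simp
    | add u v hu hv => simp only [TensorProduct.add_tmul, map_add, hu, hv]
    | tmul x y => simp
  induction w with
  | zero => simp
  | add u v hu hv => simp only [map_add, hu, hv]
  | tmul a t =>
    induction t with
    | zero => simp
    | add u v hu hv => simp only [TensorProduct.tmul_add, map_add, hu, hv]
    | tmul b c =>
      simp only [LinearMap.lTensor_tmul, TensorProduct.assoc_symm_tmul, LinearMap.rTensor_tmul,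
        h1, h2]
      exact H.coassoc a b c

/-- `T₁` as a linear equivalence. -/
def T₁Equiv : (A ⊗[k] A) ≃ₗ[k] (A ⊗[k] A) := LinearEquiv.ofBijective H.T₁ H.bijective_T₁

/-- `T₂` as a linear equivalence. -/
def T₂Equiv : (A ⊗[k] A) ≃ₗ[k] (A ⊗[k] A) := LinearEquiv.ofBijective H.T₂ H.bijective_T₂

@[simp] theorem T₁_symm (t : A ⊗[k] A) : H.T₁ (H.T₁Equiv.symm t) = t :=
  H.T₁Equiv.apply_symm_apply t

@[simp] theorem symm_T₁ (t : A ⊗[k] A) : H.T₁Equiv.symm (H.T₁ t) = t :=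
  H.T₁Equiv.symm_apply_apply t

@[simp] theorem T₂_symm (t : A ⊗[k] A) : H.T₂ (H.T₂Equiv.symm t) = t :=
  H.T₂Equiv.apply_symm_apply t

@[simp] theorem symm_T₂ (t : A ⊗[k] A) : H.T₂Equiv.symm (H.T₂ t) = t :=
  H.T₂Equiv.symm_apply_apply t

theorem mul_T (w : A ⊗[k] (A ⊗[k] A)) :
    LinearMap.lTensor A (LinearMap.mul' k A) (TensorProduct.assoc k A A A
      (LinearMap.rTensor A H.T₂ ((TensorProduct.assoc k A A A).symm w))) =
    LinearMap.rTensor A (LinearMap.mul' k A)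
      ((TensorProduct.assoc k A A A).symm (LinearMap.lTensor A H.T₁ w)) := by
  have h1 : ∀ (c : A) (t : A ⊗[k] A),
      LinearMap.lTensor A (LinearMap.mul' k A) (TensorProduct.assoc k A A A (t ⊗ₜ c)) =
        rightAct (oneTensor c) t := by
    intro c t
    induction t with
    | zero => simp
    | add u v hu hv => simp only [TensorProduct.add_tmul, map_add, hu, hv]
    | tmul x y => rfl
  have h2 : ∀ (a : A) (t : A ⊗[k] A),
      LinearMap.rTensor A (LinearMap.mul' k A) ((TensorProduct.assoc k A A A).symm (a ⊗ₜ t)) =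
        leftAct (tensorOne a) t := by
    intro a t
    induction t with
    | zero => simp
    | add u v hu hv => simp only [TensorProduct.tmul_add, map_add, hu, hv]
    | tmul x y => rfl
  induction w with
  | zero => simp
  | add u v hu hv => simp only [map_add, hu, hv]
  | tmul a t =>
    induction t with
    | zero => simp
    | add u v hu hv => simp only [TensorProduct.tmul_add, map_add, hu, hv]
    | tmul b c =>
      simp only [LinearMap.lTensor_tmul, TensorProduct.assoc_symm_tmul, LinearMap.rTensor_tmul,
        h1, h2]
      apply incl_injective (k := k) (H.nondegenerate.tensor (k := k) H.nondegenerate)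
      rw [← incl_mul, ← mul_incl, incl_T₁, incl_T₂, mul_assoc]

theorem tmul_T₁_symm (a b c : A) :
    a ⊗ₜ[k] LinearMap.mul' k A (H.T₁Equiv.symm (b ⊗ₜ c)) =
      LinearMap.mul' k A (H.T₂Equiv.symm (a ⊗ₜ b)) ⊗ₜ[k] c := by
  have key : ∀ v : A ⊗[k] (A ⊗[k] A),
      LinearMap.lTensor A (LinearMap.mul' k A ∘ₗ H.T₁Equiv.symm.toLinearMap)
        (TensorProduct.assoc k A A A (LinearMap.rTensor A H.T₂
          ((TensorProduct.assoc k A A A).symm (LinearMap.lTensor A H.T₁ v)))) =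
      LinearMap.rTensor A (LinearMap.mul' k A)
        ((TensorProduct.assoc k A A A).symm (LinearMap.lTensor A H.T₁ v)) := by
    intro v
    rw [coassoc_apply, ← mul_T, ← LinearMap.lTensor_comp_apply]
    congr 2
    ext t
    simp
  have h := key (LinearMap.lTensor A H.T₁Equiv.symm.toLinearMap
    (TensorProduct.assoc k A A A (H.T₂Equiv.symm (a ⊗ₜ b) ⊗ₜ c)))
  have h1 : H.T₁ ∘ₗ H.T₁Equiv.symm.toLinearMap = LinearMap.id := by
    ext t
    simp
  simpa [← LinearMap.lTensor_comp_apply, h1] using h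

theorem functional_mul (ε : A →ₗ[k] k)
    (h : ∀ a b : A, TensorProduct.rid k A (LinearMap.lTensor A ε (H.T₂ (a ⊗ₜ b))) = a * b)
    (y z : A) : ε (y * z) = ε y * ε z := by
  have h1 : ∀ (t : A ⊗[k] A) (c : A),
      TensorProduct.rid k A (LinearMap.lTensor A ε (rightAct (H.comul c) t)) =
        TensorProduct.rid k A (LinearMap.lTensor A ε t) * c := by
    intro t c
    rw [← H.T₂_symm t]
    induction H.T₂Equiv.symm t with
    | zero => simp
    | add u v hu hv => simp only [map_add, add_mul, hu, hv]
    | tmul a b =>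
      have h2 : rightAct (H.comul c) (H.T₂ (a ⊗ₜ b)) = H.T₂ (a ⊗ₜ (b * c)) := by
        apply incl_injective (k := k) (H.nondegenerate.tensor (k := k) H.nondegenerate)
        rw [← incl_mul, incl_T₂, incl_T₂, map_mul, mul_assoc]
      rw [h2, h, h, mul_assoc]
  have h3 : ∀ t : A ⊗[k] A,
      TensorProduct.rid k A (LinearMap.lTensor A ε (LinearMap.lTensor A (LinearMap.mulLeft k y) t)) =
        ε y • TensorProduct.rid k A (LinearMap.lTensor A ε t) := by
    intro t
    rw [← H.T₂_symm t]
    induction H.T₂Equiv.symm t with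
    | zero => simp
    | add u v hu hv => simp only [map_add, smul_add, hu, hv]
    | tmul a b =>
      have h4 : LinearMap.lTensor A (LinearMap.mulLeft k y) (H.T₂ (a ⊗ₜ b)) =
          rightAct (H.comul b) (a ⊗ₜ y) := by
        apply incl_injective (k := k) (H.nondegenerate.tensor (k := k) H.nondegenerate)
        have h5 : LinearMap.lTensor A (LinearMap.mulLeft k y) (H.T₂ (a ⊗ₜ b)) =
          leftAct (oneTensor y) (H.T₂ (a ⊗ₜ b)) := rfl
        have h6 : incl k (A ⊗[k] A) (a ⊗ₜ y) = oneTensor y * tensorOne a := by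
          apply ext_act
          · ext u v
            exact Algebra.TensorProduct.tmul_mul_tmul a u y v
          · ext u v
            exact Algebra.TensorProduct.tmul_mul_tmul u a v y
        rw [h5, ← mul_incl, incl_T₂, ← incl_mul, h6, mul_assoc]
      rw [h4, h1, h]
      simp [smul_mul_assoc]
  have h7 : ε ∘ₗ LinearMap.mulLeft k y - ε y • ε = 0 := by
    apply functional_eq_zero
    intro a b
    have := h3 (b ⊗ₜ a)
    simp only [LinearMap.lTensor_tmul, TensorProduct.rid_tmul, LinearMap.mulLeft_apply] at this
    simp [sub_smul, this, mul_smul]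
  simpa [sub_eq_zero] using LinearMap.congr_fun h7 z

theorem existsUnique_counit : ∃! ε : A →ₙₐ[k] k, H.IsCounit ε := by
  obtain ⟨ε, h1, h2⟩ := exists_functional
    (LinearMap.mul' k A ∘ₗ H.T₁Equiv.symm.toLinearMap)
    (LinearMap.mul' k A ∘ₗ H.T₂Equiv.symm.toLinearMap) H.tmul_T₁_symm
  have h3 : ∀ t : A ⊗[k] A, TensorProduct.lid k A (LinearMap.rTensor A ε t) =
      LinearMap.mul' k A (H.T₁Equiv.symm t) := by
    intro t
    induction t with
    | zero => simp
    | add u v hu hv => simp only [map_add, hu, hv]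
    | tmul a b => simpa using (h1 a b).symm
  have h4 : ∀ t : A ⊗[k] A, TensorProduct.rid k A (LinearMap.lTensor A ε t) =
      LinearMap.mul' k A (H.T₂Equiv.symm t) := by
    intro t
    induction t with
    | zero => simp
    | add u v hu hv => simp only [map_add, hu, hv]
    | tmul a b => simpa using (h2 a b).symm
  have h5 : ∀ a b : A, TensorProduct.rid k A (LinearMap.lTensor A ε (H.T₂ (a ⊗ₜ b))) = a * b :=
    fun a b => by simp [h4]
  refine ⟨{ ε with
    map_zero' := map_zero ε
    map_mul' := H.functional_mul ε h5 }, ⟨h5, fun a b => ?_⟩, ?_⟩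
  · exact (h3 _).trans (by simp)
  · rintro ε' ⟨-, h6⟩
    have h7 : ∀ t : A ⊗[k] A, TensorProduct.lid k A
        (LinearMap.rTensor A (ε' : A →ₗ[k] k) t) = LinearMap.mul' k A (H.T₁Equiv.symm t) := by
      intro t
      rw [← H.T₁_symm t]
      induction H.T₁Equiv.symm t with
      | zero => simp
      | add u v hu hv => simp only [map_add, hu, hv]
      | tmul a b => simp [h6]
    have h8 : (ε' : A →ₗ[k] k) - ε = 0 := by
      apply functional_eq_zero
      intro a b
      have := (h7 (a ⊗ₜ b)).trans (h3 (a ⊗ₜ b)).symm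
      simp only [LinearMap.rTensor_tmul, TensorProduct.lid_tmul] at this
      simp only [LinearMap.sub_apply, sub_smul, this, sub_self]
    ext a
    exact sub_eq_zero.1 (LinearMap.congr_fun h8 a)

/-- The counit `ε : A → k`. -/
def counit : A →ₙₐ[k] k := H.existsUnique_counit.choose

theorem isCounit_counit : H.IsCounit H.counit := H.existsUnique_counit.choose_spec.1

/-! #### The antipode -/

/-- `S : A → 𝕄(A)` is an antipode: `m₁ (S ⊗ A) (Δ(a)(1 ⊗ b)) = ε(a) b` and
`m₂ (A ⊗ S) ((a ⊗ 1)Δ(b)) = a ε(b)`, where `m₁ : 𝕄(A) ⊗ A → A` and `m₂ : A ⊗ 𝕄(A) → A` are the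
evaluation maps. -/
def IsAntipode (S : A →ₗ[k] Multiplier k A) : Prop :=
  (∀ a b : A, TensorProduct.lift leftAct (LinearMap.rTensor A S (H.T₁ (a ⊗ₜ b))) =
    H.counit a • b) ∧
  (∀ a b : A, TensorProduct.lift rightAct.flip (LinearMap.lTensor A S (H.T₂ (a ⊗ₜ b))) =
    H.counit b • a)

theorem exists_antipode : ∃ S : A →ₗ[k] Multiplier k A, H.IsAntipode S := by
  set ε : A →ₗ[k] k := (H.counit : A →ₗ[k] k) with hεdef
  obtain ⟨hc2, hc1⟩ := H.isCounit_counit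
  let f : A ⊗[k] A →ₗ[k] A := (TensorProduct.lid k A).toLinearMap ∘ₗ LinearMap.rTensor A ε ∘ₗ
    H.T₁Equiv.symm.toLinearMap
  let g : A ⊗[k] A →ₗ[k] A := (TensorProduct.rid k A).toLinearMap ∘ₗ LinearMap.lTensor A ε ∘ₗ
    H.T₂Equiv.symm.toLinearMap
  have hf : ∀ t, f (H.T₁ t) = TensorProduct.lid k A (LinearMap.rTensor A ε t) := by
    intro t
    simp [f]
  have hg : ∀ t, g (H.T₂ t) = TensorProduct.rid k A (LinearMap.lTensor A ε t) := by
    intro t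
    simp [g]
  have hc1' : ∀ t, TensorProduct.lid k A (LinearMap.rTensor A ε (H.T₁ t)) =
      LinearMap.mul' k A t := by
    intro t
    induction t with
    | zero => simp
    | add u v hu hv => simp only [map_add, hu, hv]
    | tmul a b => exact hc1 a b
  have hc2' : ∀ t, TensorProduct.rid k A (LinearMap.lTensor A ε (H.T₂ t)) =
      LinearMap.mul' k A t := by
    intro t
    induction t with
    | zero => simp
    | add u v hu hv => simp only [map_add, hu, hv]
    | tmul a b => exact hc2 a b
  have hl : ∀ a b c, f (a ⊗ₜ (b * c)) = f (a ⊗ₜ b) * c := by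
    intro a b c
    have h1 : ∀ t, H.T₁ (LinearMap.lTensor A (LinearMap.mulRight k c) t) =
        LinearMap.lTensor A (LinearMap.mulRight k c) (H.T₁ t) := by
      intro t
      induction t with
      | zero => simp
      | add u v hu hv => simp only [map_add, hu, hv]
      | tmul a b =>
        apply incl_injective (k := k) (H.nondegenerate.tensor (k := k) H.nondegenerate)
        have h5 : LinearMap.lTensor A (LinearMap.mulRight k c) (H.T₁ (a ⊗ₜ b)) =
          rightAct (oneTensor c) (H.T₁ (a ⊗ₜ b)) := rfl
        have h6 : (oneTensor (b * c) : Multiplier k (A ⊗[k] A)) = oneTensor b * oneTensor c := by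
          apply ext_act
          · ext u v
            simp only [oneTensor, tensor, LinearMap.coe_mk, AddHom.coe_mk, leftAct_mk,
              mul_leftAct, map_mul, TensorProduct.AlgebraTensorModule.curry_apply,
              TensorProduct.curry_apply, LinearMap.coe_restrictScalars, TensorProduct.map_tmul]
            rfl
          · ext u v
            simp only [oneTensor, tensor, LinearMap.coe_mk, AddHom.coe_mk, rightAct_mk,
              mul_rightAct, map_mul, TensorProduct.AlgebraTensorModule.curry_apply,
              TensorProduct.curry_apply, LinearMap.coe_restrictScalars, TensorProduct.map_tmul]
            rfl
        rw [LinearMap.lTensor_tmul, LinearMap.mulRight_apply, incl_T₁, h5, ← incl_mul, incl_T₁, h6,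
          mul_assoc]
    have h2 : a ⊗ₜ[k] (b * c) =
        H.T₁ (LinearMap.lTensor A (LinearMap.mulRight k c) (H.T₁Equiv.symm (a ⊗ₜ b))) := by
      rw [h1, T₁_symm]
      simp
    rw [h2, hf]
    change _ = TensorProduct.lid k A (LinearMap.rTensor A ε (H.T₁Equiv.symm (a ⊗ₜ b))) * c
    induction H.T₁Equiv.symm (a ⊗ₜ b) with
    | zero => simp
    | add u v hu hv => simp only [map_add, add_mul, hu, hv]
    | tmul x y => simp [smul_mul_assoc]
  have hr : ∀ a b c, g ((c * b) ⊗ₜ a) = c * g (b ⊗ₜ a) := by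
    intro a b c
    have h1 : ∀ t, H.T₂ (LinearMap.rTensor A (LinearMap.mulLeft k c) t) =
        LinearMap.rTensor A (LinearMap.mulLeft k c) (H.T₂ t) := by
      intro t
      induction t with
      | zero => simp
      | add u v hu hv => simp only [map_add, hu, hv]
      | tmul b a =>
        apply incl_injective (k := k) (H.nondegenerate.tensor (k := k) H.nondegenerate)
        have h5 : LinearMap.rTensor A (LinearMap.mulLeft k c) (H.T₂ (b ⊗ₜ a)) =
          leftAct (tensorOne c) (H.T₂ (b ⊗ₜ a)) := rfl
        have h6 : (tensorOne (c * b) : Multiplier k (A ⊗[k] A)) = tensorOne c * tensorOne b := by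
          apply ext_act
          · ext u v
            simp only [tensorOne, tensor, LinearMap.coe_mk, AddHom.coe_mk, leftAct_mk,
              mul_leftAct, map_mul, TensorProduct.AlgebraTensorModule.curry_apply,
              TensorProduct.curry_apply, LinearMap.coe_restrictScalars, TensorProduct.map_tmul]
            rfl
          · ext u v
            simp only [tensorOne, tensor, LinearMap.coe_mk, AddHom.coe_mk, rightAct_mk,
              mul_rightAct, map_mul, TensorProduct.AlgebraTensorModule.curry_apply,
              TensorProduct.curry_apply, LinearMap.coe_restrictScalars, TensorProduct.map_tmul]
            rfl
        rw [LinearMap.rTensor_tmul, LinearMap.mulLeft_apply, incl_T₂, h5, ← mul_incl, incl_T₂, h6,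
          mul_assoc]
    have h2 : (c * b) ⊗ₜ[k] a =
        H.T₂ (LinearMap.rTensor A (LinearMap.mulLeft k c) (H.T₂Equiv.symm (b ⊗ₜ a))) := by
      rw [h1, T₂_symm]
      simp
    rw [h2, hg]
    change _ = c * TensorProduct.rid k A (LinearMap.lTensor A ε (H.T₂Equiv.symm (b ⊗ₜ a)))
    induction H.T₂Equiv.symm (b ⊗ₜ a) with
    | zero => simp
    | add u v hu hv => simp only [map_add, mul_add, hu, hv]
    | tmul x y => simp [mul_smul_comm]
  -- the two sides agree after composition with the bijection `(A ⊗ T₁) ∘ (T₂ ⊗ A)`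
  let P : A ⊗[k] (A ⊗[k] A) →ₗ[k] A ⊗[k] (A ⊗[k] A) :=
    (TensorProduct.assoc k A A A).toLinearMap ∘ₗ LinearMap.rTensor A H.T₂ ∘ₗ
      (TensorProduct.assoc k A A A).symm.toLinearMap
  let F : A ⊗[k] (A ⊗[k] A) →ₗ[k] A := LinearMap.mul' k A ∘ₗ LinearMap.lTensor A f
  let G : A ⊗[k] (A ⊗[k] A) →ₗ[k] A := LinearMap.mul' k A ∘ₗ LinearMap.rTensor A g ∘ₗ
    (TensorProduct.assoc k A A A).symm.toLinearMap
  let M : A ⊗[k] (A ⊗[k] A) →ₗ[k] A := LinearMap.mul' k A ∘ₗ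
    LinearMap.lTensor A ((TensorProduct.lid k A).toLinearMap ∘ₗ LinearMap.rTensor A ε)
  have hMassoc : ∀ t : (A ⊗[k] A) ⊗[k] A, M (TensorProduct.assoc k A A A t) =
      LinearMap.mul' k A (LinearMap.rTensor A ((TensorProduct.rid k A).toLinearMap ∘ₗ
        LinearMap.lTensor A ε) t) := by
    intro t
    induction t with
    | zero => simp
    | add u v hu hv => simp only [map_add, hu, hv]
    | tmul t c =>
      induction t with
      | zero => simp
      | add u v hu hv => simp only [TensorProduct.add_tmul, map_add, hu, hv]
      | tmul a b => simp [M, smul_mul_assoc]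
  have hFQ : ∀ w, F (LinearMap.lTensor A H.T₁ w) = M w := by
    intro w
    simp only [F, M, LinearMap.comp_apply]
    rw [← LinearMap.lTensor_comp_apply]
    congr 2
    ext t
    simp [hf]
  have hGP : ∀ w, G (P w) = M w := by
    intro w
    obtain ⟨w, rfl⟩ := (TensorProduct.assoc k A A A).surjective w
    rw [hMassoc]
    simp only [G, P, LinearMap.comp_apply, LinearEquiv.coe_coe, LinearEquiv.symm_apply_apply]
    rw [← LinearMap.rTensor_comp_apply]
    congr 2
    ext t
    simp [hg]
  have hMP : ∀ w, M (P w) = M (LinearMap.lTensor A H.T₁ w) := by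
    have h1 : ∀ a b c, M (P (a ⊗ₜ (b ⊗ₜ c))) = a * b * c := by
      intro a b c
      simp only [P, LinearMap.comp_apply, LinearEquiv.coe_coe, hMassoc]
      simpa using congrArg (· * c) (hc2' (a ⊗ₜ b))
    have h2 : ∀ a b c, M (LinearMap.lTensor A H.T₁ (a ⊗ₜ (b ⊗ₜ c))) = a * (b * c) := by
      intro a b c
      simpa [M] using congrArg (a * ·) (hc1' (b ⊗ₜ c))
    intro w
    induction w with
    | zero => simp
    | add u v hu hv => simp only [map_add, hu, hv]
    | tmul a t =>
      induction t with
      | zero => simp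
      | add u v hu hv => simp only [TensorProduct.tmul_add, map_add, hu, hv]
      | tmul b c => rw [h1, h2, mul_assoc]
  have hPQ : ∀ w, P (LinearMap.lTensor A H.T₁ w) = LinearMap.lTensor A H.T₁ (P w) :=
    H.coassoc_apply
  have hQs : Function.Surjective (LinearMap.lTensor A H.T₁) :=
    LinearMap.lTensor_surjective A H.bijective_T₁.2
  have hPs : Function.Surjective P := by
    have := LinearMap.rTensor_surjective A H.bijective_T₂.2
    exact (TensorProduct.assoc k A A A).surjective.comp
      (this.comp (TensorProduct.assoc k A A A).symm.surjective)
  have hFG : ∀ w, F w = G w := by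
    intro w
    obtain ⟨w, rfl⟩ := hPs w
    obtain ⟨w, rfl⟩ := hQs w
    rw [hGP, hPQ, hFQ, hMP]
  have hcompat : ∀ a b c, c * f (a ⊗ₜ b) = g (c ⊗ₜ a) * b := fun a b c =>
    hFG (c ⊗ₜ (a ⊗ₜ b))
  let S : A →ₗ[k] Multiplier k A :=
    { toFun := fun a => Multiplier.mk (TensorProduct.curry f a) ((TensorProduct.curry g).flip a)
        (fun b c => hl a b c) (fun b c => hr a c b) (fun c b => hcompat a b c)
      map_add' := fun a b => ext_act (map_add (TensorProduct.curry f) a b)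
        (map_add (TensorProduct.curry g).flip a b)
      map_smul' := fun c a => ext_act (map_smul (TensorProduct.curry f) c a)
        (map_smul (TensorProduct.curry g).flip c a) }
  have hS1 : ∀ t, TensorProduct.lift leftAct (LinearMap.rTensor A S t) = f t := by
    intro t
    induction t with
    | zero => simp
    | add u v hu hv => simp only [map_add, hu, hv]
    | tmul a b => rfl
  have hS2 : ∀ t, TensorProduct.lift rightAct.flip (LinearMap.lTensor A S t) = g t := by
    intro t
    induction t with
    | zero => simp
    | add u v hu hv => simp only [map_add, hu, hv]
    | tmul a b => rfl
  refine ⟨S, fun a b => ?_, fun a b => ?_⟩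
  · rw [hS1, hf]
    simp [hεdef]
  · rw [hS2, hg]
    simp [hεdef]

/-- The antipode `S : A → 𝕄(A)`. -/
def antipode : A →ₗ[k] Multiplier k A := H.exists_antipode.choose

theorem isAntipode_antipode : H.IsAntipode H.antipode := H.exists_antipode.choose_spec

/-! #### Convolution on `Hom(A, 𝕄(A))` -/

/-- The local product `b ↦ f ∗ᵇ g`, with
`(f ∗ᵇ g)(a) = μ((f ⊗ g)(Δ(a)(1 ⊗ b))) = f(a_(1,b)) g(a_(2,b))`. -/
def convUpper (f g : A →ₗ[k] Multiplier k A) : A →ₗ[k] A →ₗ[k] Multiplier k A :=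
  (TensorProduct.curry
    (LinearMap.mul' k (Multiplier k A) ∘ₗ TensorProduct.map f g ∘ₗ H.T₁)).flip

/-- The local product `b ↦ f ∗_b g`, with
`(f ∗_b g)(a) = μ((f ⊗ g)((b ⊗ 1)Δ(a))) = f(a_(b,1)) g(a_(b,2))`. -/
def convLower (f g : A →ₗ[k] Multiplier k A) : A →ₗ[k] A →ₗ[k] Multiplier k A :=
  TensorProduct.curry (LinearMap.mul' k (Multiplier k A) ∘ₗ TensorProduct.map f g ∘ₗ H.T₂)

/-- The local unit `α : b ↦ α_b`, with `α_b(a) = ε(a) ι_A(b)`. -/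
def convUnit : A →ₗ[k] A →ₗ[k] Multiplier k A :=
  LinearMap.smulRightₗ (H.counit : A →ₗ[k] k) ∘ₗ (incl k A : A →ₗ[k] Multiplier k A)

/-- `g` is a (left-right) convolution inverse of `f` in `Hom(A, 𝕄(A))`:
`g ∗ᵇ f = α_b = f ∗_b g` for all `b`. -/
def IsConvolutionInverse (g f : A →ₗ[k] Multiplier k A) : Prop :=
  H.convUpper g f = H.convUnit ∧ H.convLower f g = H.convUnit

end MultiplierHopfAlgebra
end Hopf

end MultiplierHopf

end

namespace MultiplierHopf

open Multiplier

variable {k A : Type*} [CommRing k] [NonUnitalRing A] [Module k A]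
  [IsScalarTower k A A] [SMulCommClass k A A]

/-! The algebra $A$ sits in $\mathbb M(A)$ as a two-sided ideal: $x\,\iota_A(b)=\iota_A(x\rhd b)$
and $\iota_A(a)\,x=\iota_A(a\lhd x)$. Hence a convolution product in which one factor is $\iota_A$
takes values in $\iota_A(A)$, and the product in $\mathbb M(A)$ turns into an action on $A$:
$(S\ast^b\iota_A)(a)=\iota_A(S(a_{(1,b)})\rhd a_{(2,b)})$ and $(\iota_A\ast_a
S)(b)=\iota_A(b_{(a,1)}\lhd S(b_{(a,2)}))$. The local unit also lies in the image,
$\alpha_b(a)=\iota_A(\varepsilon(a)b)$. Since $A$ is non-degenerate, $\iota_A$ is injective and can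
be cancelled, so the two convolution identities are exactly the two antipode equations; this is
`isConvolutionInverse_incl_iff`.

It remains to identify a solution of these equations with `H.antipode`, which is known only as some
chosen solution. Uniqueness, `IsAntipode.unique`, comes from the surjectivity of $T_1$ and $T_2$:
the equations prescribe the actions of $S$ on the images of these maps, that is, on all of $A\otimes
A$, and a multiplier is determined by its two actions. -/

/-! ### Products in `Multiplier k A` with one factor coming from `A` -/

/-- The linear extension of `mul_incl`. A general tensor is needed because the lemma is applied to
`H.T₁ (a ⊗ₜ b)`, which need not be elementary. -/
theorem mul'_map_incl_right (S : A →ₗ[k] Multiplier k A) (t : A ⊗[k] A) :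
    LinearMap.mul' k (Multiplier k A)
        (TensorProduct.map S (incl k A : A →ₗ[k] Multiplier k A) t) =
      incl k A (TensorProduct.lift leftAct (LinearMap.rTensor A S t)) := by
  induction t with
  | zero => simp
  | add u v hu hv => simp only [map_add, hu, hv]
  | tmul a b => exact mul_incl (S a) b

/-- The mirror image, resting on `incl_mul`. The `flip` appears because `rightAct` takes the
multiplier first, whereas here the element of `A` is the left tensor factor. -/
theorem mul'_map_incl_left (S : A →ₗ[k] Multiplier k A) (t : A ⊗[k] A) :
    LinearMap.mul' k (Multiplier k A)
        (TensorProduct.map (incl k A : A →ₗ[k] Multiplier k A) S t) =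
      incl k A (TensorProduct.lift rightAct.flip (LinearMap.lTensor A S t)) := by
  induction t with
  | zero => simp
  | add u v hu hv => simp only [map_add, hu, hv]
  | tmul a b => exact incl_mul (S b) a

namespace MultiplierHopfAlgebra

variable [Module.Projective k A] (H : MultiplierHopfAlgebra k A)

/-! ### Convolution identities against antipode equations -/

theorem convUpper_incl (S : A →ₗ[k] Multiplier k A) (a b : A) :
    H.convUpper S (incl k A : A →ₗ[k] Multiplier k A) b a =
      incl k A (TensorProduct.lift leftAct (LinearMap.rTensor A S (H.T₁ (a ⊗ₜ b)))) :=
  -- The `curry` and `flip` in `convUpper` unfold definitionally, so the left side already is the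
  -- product map applied to `H.T₁ (a ⊗ₜ b)`; the covering element `b` is the first argument of
  -- `convUpper` but the second tensor factor.
  mul'_map_incl_right S _

/-- No exchange of arguments occurs here: `T₂` is covered by its first tensor factor, so `a` is the
covering element and `b` the point of evaluation. -/
theorem convLower_incl (S : A →ₗ[k] Multiplier k A) (a b : A) :
    H.convLower (incl k A : A →ₗ[k] Multiplier k A) S a b =
      incl k A (TensorProduct.lift rightAct.flip (LinearMap.lTensor A S (H.T₂ (a ⊗ₜ b)))) :=
  mul'_map_incl_left S _

/-- Moving the scalar inside `incl` exhibits the local unit in the form of the right-hand sides of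
the antipode equations, ready for cancelling `incl`. -/
theorem convUnit_apply (a b : A) : H.convUnit b a = incl k A (H.counit a • b) :=
  (map_smul (incl k A) (H.counit a) b).symm

theorem isConvolutionInverse_incl_iff (S : A →ₗ[k] Multiplier k A) :
    H.IsConvolutionInverse S (incl k A : A →ₗ[k] Multiplier k A) ↔ H.IsAntipode S := by
  -- Non-degeneracy enters the equivalence only here, to pass from identities in `Multiplier k A`
  -- back to identities in `A`.
  have hinj := incl_injective (k := k) H.nondegenerate
  constructor
  · rintro ⟨h1, h2⟩
    refine ⟨fun a b => hinj ?_, fun a b => hinj ?_⟩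
    · rw [← convUpper_incl, h1, convUnit_apply]
    · rw [← convLower_incl, h2, convUnit_apply]
  · rintro ⟨h1, h2⟩
    -- The covering element is introduced first in both goals; it is `b` for the upper product and
    -- `a` for the lower one, matching the conventions of `T₁` and `T₂`.
    refine ⟨LinearMap.ext fun b => LinearMap.ext fun a => ?_,
      LinearMap.ext fun a => LinearMap.ext fun b => ?_⟩
    · rw [convUpper_incl, h1, convUnit_apply]
    · rw [convLower_incl, h2, convUnit_apply]

/-! ### Uniqueness of the antipode -/

variable {H} in
theorem IsAntipode.unique {S S' : A →ₗ[k] Multiplier k A} (hS : H.IsAntipode S)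
    (hS' : H.IsAntipode S') : S = S' := by
  have h1 : TensorProduct.lift leftAct ∘ₗ LinearMap.rTensor A S =
      TensorProduct.lift leftAct ∘ₗ LinearMap.rTensor A S' := by
    -- Surjectivity of `T₁` lets it be cancelled on the right. After composition with `T₁`, both
    -- sides send `a ⊗ b` to `ε(a) b` by the first antipode equation.
    rw [← LinearMap.cancel_right H.bijective_T₁.2]
    exact TensorProduct.ext' fun a b => (hS.1 a b).trans (hS'.1 a b).symm
  have h2 : TensorProduct.lift rightAct.flip ∘ₗ LinearMap.lTensor A S =
      TensorProduct.lift rightAct.flip ∘ₗ LinearMap.lTensor A S' := by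
    rw [← LinearMap.cancel_right H.bijective_T₂.2]
    exact TensorProduct.ext' fun a b => (hS.2 a b).trans (hS'.2 a b).symm
  ext a
  -- On elementary tensors `h1` compares the left actions of `S a` and `S' a`, and `h2` their right
  -- actions; the element acted on is the first tensor factor in `h2`.
  exact ext_act (LinearMap.ext fun b => LinearMap.congr_fun h1 (a ⊗ₜ b))
    (LinearMap.ext fun b => LinearMap.congr_fun h2 (b ⊗ₜ a))

end MultiplierHopfAlgebra

end MultiplierHopf

theorem proposition3p6 {k A : Type*} [CommRing k] [NonUnitalRing A] [Module k A]
    [IsScalarTower k A A] [SMulCommClass k A A] [Module.Projective k A]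
    (H : MultiplierHopf.MultiplierHopfAlgebra k A) (S : A →ₗ[k] MultiplierHopf.Multiplier k A) :
    S = H.antipode ↔
      H.IsConvolutionInverse S (MultiplierHopf.Multiplier.incl k A :
        A →ₗ[k] MultiplierHopf.Multiplier k A) := by
  rw [H.isConvolutionInverse_incl_iff]
  -- The forward direction needs only that the chosen `H.antipode` solves the antipode equations;
  -- the converse needs their uniqueness.
  exact ⟨fun h => h ▸ H.isAntipode_antipode, fun h => h.unique H.isAntipode_antipode⟩
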